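/- Let $G$ be a (discrete) group and let $A\trianglelefteq G$ be a finitely generated abelian normal subgroup of finite index $[G:A]$ (so that $(G,A)$ is a *group-lattice pair*). Write $\widehat A=\operatorname{Hom}(A,\mathbb T)$ for the Pontryagin dual of $A$, on which $G/A$ acts by $(gA\cdot\chi)(a)=\chi(g^{-1}ag)$, and write $\mathcal O_\chi$ for the orbit of $\chi\in\widehat A$. The pair $(G,A)$ is called *crystal-like* if some $\chi\in\widehat A$ has a principal orbit, that is, $|\mathcal O_\chi|=[G:A]$. Let $\widehat G$ be the set of equivalence classes of irreducible unitary representations of $G$ on (nonzero, possibly infinite-dimensional) complex Hilbert spaces. Then: 1. $\dim\pi\le[G:A]$ for every $\pi\in\widehat G$; in particular every irreducible unitary representation of $G$ is finite-dimensional. 2. There is $\pi\in\widehat G$ with $\dim\pi=[G:A]$ if and only if the action of $G/A$ on $\widehat A$ has a principal orbit. 3. $(G,A)$ is crystal-like if and only if $\max\{\dim\pi : \pi\in\widehat G\}=[G:A]$. -/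

import Mathlib

universe u v

/-- `(G, A)` is a group-lattice pair: `A` is a normal, abelian, finitely generated subgroup of `G`
of finite index. -/
class IsGroupLatticePair {G : Type u} [Group G] (A : Subgroup G) : Prop
    extends A.Normal, IsMulCommutative A, A.FiniteIndex where
  fg : A.FG

section Characters

variable {G : Type u} [Group G] (A : Subgroup G)

/-- The conjugation action of `G` on the characters of a normal subgroup `A`:
`(g • χ) a = χ (g⁻¹ * a * g)`. -/
noncomputable def conjCharAction [A.Normal] : G →* Equiv.Perm (A →* Circle) where
  toFun g :=
    { toFun := fun χ => χ.comp (MulAut.conjNormal g⁻¹ : MulAut A).toMonoidHom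
      invFun := fun χ => χ.comp (MulAut.conjNormal g : MulAut A).toMonoidHom
      left_inv := fun χ => by ext a; simp
      right_inv := fun χ => by ext a; simp }
  map_one' := by ext χ a; simp
  map_mul' g h := by ext χ a; simp

theorem conjCharAction_apply [A.Normal] (g : G) (χ : A →* Circle) (a b : A)
    (hb : (b : G) = g⁻¹ * a * g) : conjCharAction A g χ a = χ b := by
  have : (MulAut.conjNormal g⁻¹ : MulAut A) a = b := by ext; simp [hb]
  rw [← this]; rfl

theorem le_ker_conjCharAction [A.Normal] [IsMulCommutative A] :
    A ≤ (conjCharAction A).ker := by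
  intro g hg
  rw [MonoidHom.mem_ker]
  ext χ a
  have hcomm : (⟨g, hg⟩ : A) * a = a * ⟨g, hg⟩ := mul_comm' _ _
  have hcomm' : g * (a : G) = a * g := congrArg Subtype.val hcomm
  rw [conjCharAction_apply A g χ a a (by rw [mul_assoc, ← hcomm', inv_mul_cancel_left])]
  rfl

/-- The action of the point group `G ⧸ A` on the Pontryagin dual of the (discrete) abelian group
`A`, induced by conjugation. -/
noncomputable def pointGroupAction [A.Normal] [IsMulCommutative A] : G ⧸ A →* Equiv.Perm (A →* Circle) :=
  QuotientGroup.lift A (conjCharAction A) (le_ker_conjCharAction A)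

/-- The orbit of a character `χ` of `A` under the point group. -/
def charOrbit [A.Normal] [IsMulCommutative A] (χ : A →* Circle) : Set (A →* Circle) :=
  Set.range fun d : G ⧸ A => pointGroupAction A d χ

/-- The orbit of `χ` is principal if it has exactly `[G : A]` elements. -/
def HasPrincipalOrbit [A.Normal] [IsMulCommutative A] (χ : A →* Circle) : Prop :=
  (charOrbit A χ).encard = (A.index : ℕ∞)

/-- `(G, A)` is crystal-like if some character of `A` has a principal orbit. -/
def IsCrystalLike [A.Normal] [IsMulCommutative A] : Prop :=
  ∃ χ : A →* Circle, HasPrincipalOrbit A χ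

end Characters

section Representations

/-- A unitary representation on a Hilbert space is (topologically) irreducible if the space is
nonzero and the only closed invariant subspaces are the trivial ones. -/
def IsIrreducibleUnitaryRep {G : Type u} [Group G] {H : Type v} [NormedAddCommGroup H]
    [InnerProductSpace ℂ H] [CompleteSpace H] (π : G →* unitary (H →L[ℂ] H)) : Prop :=
  Nontrivial H ∧ ∀ K : Submodule ℂ H, IsClosed (K : Set H) →
    (∀ g : G, ∀ x ∈ K, (π g : H →L[ℂ] H) x ∈ K) → K = ⊥ ∨ K = ⊤

/-- The dimension of a Hilbert space, as an element of `{0, 1, 2, …, ∞}`. (The algebraic dimension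
and the cardinality of an orthonormal basis have the same value here: they agree when one of them
is finite, and every infinite cardinal is sent to `∞`.) -/
noncomputable def hilbertDim (H : Type v) [NormedAddCommGroup H] [InnerProductSpace ℂ H] : ℕ∞ :=
  Cardinal.toENat (Module.rank ℂ H)

/-- The set of dimensions of the irreducible unitary representations of the discrete group `G`
on Hilbert spaces, of finite or infinite dimension. -/
def irreducibleDims (G : Type u) [Group G] : Set ℕ∞ :=
  {d | ∃ (H : Type v) (_ : NormedAddCommGroup H) (_ : InnerProductSpace ℂ H)
    (_ : CompleteSpace H) (π : G →* unitary (H →L[ℂ] H)),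
    IsIrreducibleUnitaryRep π ∧ hilbertDim H = d}

end Representations


/-!
Let `π` be irreducible. The *-algebra `B` generated by `π(A)` is commutative and reduced, and the
finite group of automorphisms of `B` induced by conjugation has only scalar invariants by Schur's
lemma. So `B` has finitely many primes, permuted transitively, and is a finite product of copies
of `ℂ`; a primitive idempotent of `B` projects onto a space on which `A` acts by a character `χ`.
If `w` spans a line stabilized by a subgroup `S ≤ G` of finite index, its translates under coset
representatives of `S` span the representation, so `dim π ≤ [G : S]`. With `S = A` this is the
dimension bound. If the dimension is `[G : A]` and `k` fixes `χ`, then `π k` has an eigenvector in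
the `χ`-weight space, whose line is stabilized by `A` and `k`; this forces `k ∈ A`, so the orbit
of `χ` is principal. Conversely, the representation induced from `χ` with principal orbit is
irreducible: its weights are distinct, hence linearly independent, and `G` permutes the weight
lines transitively.
-/

section FiniteGroupInvariants

open scoped Pointwise

variable {k B Γ : Type*} [Field k] [CommRing B] [Algebra k B] [Group Γ] [Finite Γ]
  [MulSemiringAction Γ B] [SMulCommClass Γ k B] [Algebra.IsInvariant k B Γ]

include k Γ in
theorem finite_setOf_isPrime_of_isInvariant : {P : Ideal B | P.IsPrime}.Finite := by
  have under_eq_bot (P : Ideal B) (hP : P.IsPrime) : P.under k = ⊥ :=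
    (P.under k).eq_bot_of_prime
  rcases Set.eq_empty_or_nonempty {P : Ideal B | P.IsPrime} with h | ⟨P, hP⟩
  · rw [h]
    exact Set.finite_empty
  · have : P.IsPrime := hP
    refine (Set.finite_range fun γ : Γ => γ • P).subset fun Q (hQ : Q.IsPrime) => ?_
    obtain ⟨γ, hγ⟩ := Algebra.IsInvariant.exists_smul_of_under_eq k B Γ P Q
      ((under_eq_bot P hP).trans (under_eq_bot Q hQ).symm)
    exact ⟨γ, hγ.symm⟩

theorem exists_notMem_mem_of_finite_isPrime {R : Type*} [CommRing R]
    (hfin : {P : Ideal R | P.IsPrime}.Finite) (hmax : ∀ P : Ideal R, P.IsPrime → P.IsMaximal)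
    (M : Ideal R) [M.IsPrime] :
    ∃ b ∉ M, ∀ P : Ideal R, P.IsPrime → P ≠ M → b ∈ P := by
  classical
  have hinf : ¬ (hfin.toFinset.erase M).inf id ≤ M := by
    rw [‹M.IsPrime›.inf_le']
    rintro ⟨P, hP, hPM⟩
    simp only [Finset.mem_erase, Set.Finite.mem_toFinset, Set.mem_ofPred_eq] at hP
    exact hP.1 ((hmax P hP.2).eq_of_le Ideal.IsPrime.ne_top' hPM)
  obtain ⟨b, hb, hbM⟩ := SetLike.not_le_iff_exists.1 hinf
  refine ⟨b, hbM, fun P hP hPM => ?_⟩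
  exact Finset.inf_le (f := id) (Finset.mem_erase.2 ⟨hPM, hfin.mem_toFinset.2 hP⟩) hb

include Γ in
theorem exists_algHom_exists_mul_eq_smul [IsAlgClosed k] [Nontrivial B] [IsReduced B] :
    ∃ φ : B →ₐ[k] k, ∃ b : B, b ≠ 0 ∧ ∀ x, x * b = φ x • b := by
  have : Algebra.IsIntegral k B := Algebra.IsInvariant.isIntegral k B Γ
  obtain ⟨M, hM⟩ := Ideal.exists_maximal B
  let e : k ≃ₐ[k] B ⧸ M := AlgEquiv.ofBijective (Algebra.ofId k (B ⧸ M))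
    IsAlgClosed.algebraMap_bijective_of_isIntegral
  let φ : B →ₐ[k] k := e.symm.toAlgHom.comp (Ideal.Quotient.mkₐ k M)
  have sub_mem (x : B) : x - algebraMap k B (φ x) ∈ M := by
    rw [← Ideal.Quotient.eq]
    exact (e.apply_symm_apply (Ideal.Quotient.mk M x)).symm
  obtain ⟨b, hbM, hb⟩ := exists_notMem_mem_of_finite_isPrime
    (finite_setOf_isPrime_of_isInvariant (k := k) (B := B) (Γ := Γ))
    (fun P _ => Ideal.isMaximal_of_isIntegral_of_isMaximal_comap (R := k) P
      ((P.comap (algebraMap k B)).eq_bot_of_prime ▸ Ideal.bot_isMaximal)) M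
  -- As `b` lies in every prime other than `M`, the product `(x - φ x) * b` lies in all of them.
  refine ⟨φ, b, fun h => hbM (h ▸ M.zero_mem), fun x => ?_⟩
  have hprime (P : Ideal B) (hP : P.IsPrime) : (x - algebraMap k B (φ x)) * b ∈ P := by
    by_cases hPM : P = M
    · exact hPM ▸ M.mul_mem_right b (sub_mem x)
    · exact P.mul_mem_left _ (hb P hP hPM)
  have hzero := (nilpotent_iff_mem_prime.2 hprime).eq_zero
  rwa [sub_mul, sub_eq_zero, ← Algebra.smul_def] at hzero

end FiniteGroupInvariants

section NormalElements

variable {R : Type*} [CStarAlgebra R]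

theorem exists_mul_eq_zero_of_forall_ne_algebraMap [Nontrivial R] {T : R} [IsStarNormal T]
    (hT : ∀ c : ℂ, T ≠ algebraMap ℂ R c) :
    ∃ f g : ℂ → ℂ, cfc f T ≠ 0 ∧ cfc g T ≠ 0 ∧ cfc f T * cfc g T = 0 := by
  obtain ⟨l, hl⟩ : (spectrum ℂ T).Nonempty := spectrum.nonempty T
  obtain ⟨m, hm, hml⟩ : ∃ m ∈ spectrum ℂ T, m ≠ l := by
    by_contra! h
    exact hT l (CFC.eq_algebraMap_of_spectrum_subset_singleton T l h)
  -- `cfc` of the positive and negative parts of `d`, which changes sign on the spectrum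
  let d : ℂ → ℝ := fun z => dist z l - dist z m
  have cfc_ne_zero {f : ℂ → ℂ} (hf : Continuous f) {z : ℂ} (hz : z ∈ spectrum ℂ T)
      (hfz : f z ≠ 0) : cfc f T ≠ 0 := by
    intro h
    have hmem : f z ∈ spectrum ℂ (cfc f T) := by
      rw [cfc_map_spectrum (R := ℂ) f T (hf := hf.continuousOn)]
      exact Set.mem_image_of_mem f hz
    rw [h, spectrum.zero_eq] at hmem
    exact hfz hmem
  have hdm : 0 < d m := by simpa [d] using hml
  have hdl : d l < 0 := by simpa [d] using hml.symm
  have hf : Continuous fun z => ((d z ⊔ 0 : ℝ) : ℂ) := by fun_prop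
  have hg : Continuous fun z => ((-d z ⊔ 0 : ℝ) : ℂ) := by fun_prop
  refine ⟨_, _, cfc_ne_zero hf hm ?_, cfc_ne_zero hg hl ?_, ?_⟩
  · simpa using hdm
  · simpa using hdl
  · rw [← cfc_mul _ _ T hf.continuousOn hg.continuousOn, ← cfc_zero ℂ T]
    refine cfc_congr fun z _ => ?_
    rw [← Complex.ofReal_mul]
    rcases le_total (d z) 0 with h | h <;> simp [h]

theorem eq_zero_of_sq_eq_zero_of_isStarNormal {T : R} [hn : IsStarNormal T] (hT : T ^ 2 = 0) :
    T = 0 := by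
  have hsq : star (star T * T) * (star T * T) = 0 := by
    rw [star_mul, star_star, mul_assoc, ← mul_assoc T, ← hn.star_comm_self.eq, mul_assoc, ← sq, hT,
      mul_zero, mul_zero]
  rwa [CStarRing.star_mul_self_eq_zero_iff, CStarRing.star_mul_self_eq_zero_iff] at hsq

theorem isStarNormal_coe_of_isMulCommutative (B : StarSubalgebra ℂ R) [IsMulCommutative B] (x : B) :
    IsStarNormal (x : R) :=
  ⟨setLike_mul_comm (star_mem x.2) x.2⟩

open scoped IsMulCommutative in
theorem isReduced_of_isMulCommutative (B : StarSubalgebra ℂ R) [IsMulCommutative B] :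
    IsReduced B := by
  refine (isReduced_iff_pow_one_lt 2 one_lt_two).2 fun x hx => Subtype.ext ?_
  have := isStarNormal_coe_of_isMulCommutative B x
  exact eq_zero_of_sq_eq_zero_of_isStarNormal (congrArg Subtype.val hx)

end NormalElements

section ImageAlgebra

variable {R : Type*} [CStarAlgebra R] {G : Type*} [Group G] (π : G →* unitary R)

/-- The *-algebra generated by the operators `π a`, `a ∈ A`. It is not completed to a C*-algebra:
being generated by `π '' A` makes invariance under conjugation immediate. -/
noncomputable def imageStarAlgebra (A : Subgroup G) : StarSubalgebra ℂ R :=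
  StarAlgebra.adjoin ℂ ((fun g => (π g : R)) '' A)

theorem apply_mem_imageStarAlgebra {A : Subgroup G} (a : A) :
    (π a : R) ∈ imageStarAlgebra π A :=
  StarAlgebra.subset_adjoin ℂ _ (Set.mem_image_of_mem _ a.2)

theorem isMulCommutative_imageStarAlgebra (A : Subgroup G) [IsMulCommutative A] :
    IsMulCommutative (imageStarAlgebra π A) := by
  have hcomm {a b : G} (ha : a ∈ A) (hb : b ∈ A) : (π a : R) * π b = π b * π a := by
    rw [← Submonoid.coe_mul, ← Submonoid.coe_mul, ← map_mul, ← map_mul, setLike_mul_comm ha hb]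
  refine StarAlgebra.isMulCommutative_adjoin ℂ ?_ ?_
  · rintro _ ⟨a, ha, rfl⟩ _ ⟨b, hb, rfl⟩
    exact hcomm ha hb
  · rintro _ ⟨a, ha, rfl⟩ _ ⟨b, hb, rfl⟩
    simpa only [map_inv, ← Unitary.star_eq_inv, Unitary.coe_star] using hcomm ha (A.inv_mem hb)

theorem conj_mem_imageStarAlgebra (A : Subgroup G) [A.Normal] (g : G) {x : R}
    (hx : x ∈ imageStarAlgebra π A) :
    Unitary.conjStarAlgAut ℂ R (π g) x ∈ imageStarAlgebra π A := by
  let f : R →⋆ₐ[ℂ] R := Unitary.conjStarAlgAut ℂ R (π g)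
  have himage : f '' ((fun a => (π a : R)) '' A) ⊆ (fun a => (π a : R)) '' A := by
    rintro _ ⟨_, ⟨a, ha, rfl⟩, rfl⟩
    refine ⟨g * a * g⁻¹, ‹A.Normal›.conj_mem a ha g, ?_⟩
    change _ = Unitary.conjStarAlgAut ℂ R (π g) (π a)
    simp only [Unitary.conjStarAlgAut_apply, map_mul, map_inv, ← Unitary.star_eq_inv,
      Submonoid.coe_mul, Unitary.coe_star]
  have hmap : f x ∈ (imageStarAlgebra π A).map f := StarSubalgebra.mem_map.2 ⟨x, hx, rfl⟩
  rw [imageStarAlgebra, StarAlgHom.map_adjoin] at hmap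
  exact StarAlgebra.adjoin_mono himage hmap

/-- The action of `G` on `imageStarAlgebra π A` by conjugation `x ↦ π g * x * (π g)⁻¹`. -/
noncomputable def conjAlgAut (A : Subgroup G) [A.Normal] :
    G →* (imageStarAlgebra π A ≃ₐ[ℂ] imageStarAlgebra π A) where
  toFun g :=
    { toFun := fun x => ⟨Unitary.conjStarAlgAut ℂ R (π g) x, conj_mem_imageStarAlgebra π A g x.2⟩
      invFun := fun x =>
        ⟨Unitary.conjStarAlgAut ℂ R (π g⁻¹) x, conj_mem_imageStarAlgebra π A g⁻¹ x.2⟩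
      left_inv := fun x => Subtype.ext <| (Unitary.conjStarAlgAut_mul_apply _ _ _).symm.trans <| by
        rw [← map_mul, inv_mul_cancel, map_one, map_one, StarAlgEquiv.one_apply]
      right_inv := fun x => Subtype.ext <| (Unitary.conjStarAlgAut_mul_apply _ _ _).symm.trans <| by
        rw [← map_mul, mul_inv_cancel, map_one, map_one, StarAlgEquiv.one_apply]
      map_mul' := fun x y => Subtype.ext <| map_mul _ _ _
      map_add' := fun x y => Subtype.ext <| map_add _ _ _
      commutes' := fun c => Subtype.ext <|
        AlgEquivClass.commutes (Unitary.conjStarAlgAut ℂ R (π g)) c }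
  map_one' := by ext x; simp
  map_mul' g h := by ext x; simp

theorem coe_conjAlgAut_apply (A : Subgroup G) [A.Normal] (g : G)
    (x : imageStarAlgebra π A) :
    (conjAlgAut π A g x : R) = π g * x * star (π g : R) :=
  Unitary.conjStarAlgAut_apply _ _

theorem conjAlgAut_apply_eq_iff (A : Subgroup G) [A.Normal] {g : G}
    {x : imageStarAlgebra π A} : conjAlgAut π A g x = x ↔ Commute (π g : R) x := by
  rw [Subtype.ext_iff, coe_conjAlgAut_apply, commute_iff_eq, ← Unitary.mul_left_inj (π g),
    mul_assoc, Unitary.star_mul_self_of_mem (π g).2, mul_one]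

theorem le_ker_conjAlgAut (A : Subgroup G) [A.Normal] [IsMulCommutative A] :
    A ≤ (conjAlgAut π A).ker := by
  intro a ha
  have := isMulCommutative_imageStarAlgebra π A
  refine AlgEquiv.ext fun x => ?_
  exact (conjAlgAut_apply_eq_iff π A).2
    (setLike_mul_comm (apply_mem_imageStarAlgebra π ⟨a, ha⟩) x.2)

instance finite_range_conjAlgAut (A : Subgroup G) [A.Normal]
    [IsMulCommutative A] [A.FiniteIndex] : Finite (conjAlgAut π A).range := by
  have := Subgroup.finiteIndex_of_le (le_ker_conjAlgAut π A)
  exact .of_equiv _ (QuotientGroup.quotientKerEquivRange (conjAlgAut π A)).toEquiv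

end ImageAlgebra

theorem commute_star_apply_of_commute {G R : Type*} [Group G] [Monoid R]
    [StarMul R] {π : G →* unitary R} {T : R}
    (hT : ∀ g, Commute (π g : R) T) (g : G) : Commute (π g : R) (star T) := by
  simpa only [map_inv, ← Unitary.star_eq_inv, Unitary.coe_star, star_star] using (hT g⁻¹).star_star

section Schur

variable {G : Type*} [Group G] {H : Type*} [NormedAddCommGroup H] [InnerProductSpace ℂ H]
  [CompleteSpace H] {π : G →* unitary (H →L[ℂ] H)}

theorem IsIrreducibleUnitaryRep.eq_zero_or_eq_zero_of_mul_eq_zero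
    (hπ : IsIrreducibleUnitaryRep π) {S T : H →L[ℂ] H} (hS : ∀ g, Commute (π g : H →L[ℂ] H) S)
    (hST : S * T = 0) : S = 0 ∨ T = 0 := by
  have hinv (g : G) (x : H) (hx : x ∈ S.ker) : (π g : H →L[ℂ] H) x ∈ S.ker := by
    have h : S ((π g : H →L[ℂ] H) x) = (π g : H →L[ℂ] H) (S x) :=
      DFunLike.congr_fun (hS g).eq.symm x
    rw [LinearMap.mem_ker] at hx ⊢
    rw [ContinuousLinearMap.coe_coe] at hx ⊢
    rw [h, hx, map_zero]
  rcases hπ.2 S.ker S.isClosed_ker hinv with h | h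
  · right
    ext x
    have hx : T x ∈ S.ker := DFunLike.congr_fun hST x
    rwa [h, Submodule.mem_bot] at hx
  · left
    ext x
    have : x ∈ S.ker := h ▸ Submodule.mem_top
    exact this

theorem IsIrreducibleUnitaryRep.exists_eq_algebraMap_of_isStarNormal
    (hπ : IsIrreducibleUnitaryRep π) {T : H →L[ℂ] H} [IsStarNormal T]
    (hT : ∀ g, Commute (π g : H →L[ℂ] H) T) : ∃ c : ℂ, T = algebraMap ℂ (H →L[ℂ] H) c := by
  by_contra! hne
  have := hπ.1
  obtain ⟨f, g, hf, hg, hfg⟩ := exists_mul_eq_zero_of_forall_ne_algebraMap hne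
  have hcomm (γ : G) : Commute (π γ : H →L[ℂ] H) (cfc f T) :=
    ((hT γ).symm.cfc (commute_star_apply_of_commute hT γ).symm f).symm
  exact (hπ.eq_zero_or_eq_zero_of_mul_eq_zero hcomm hfg).elim hf hg

variable {A : Subgroup G} [A.Normal] [IsMulCommutative A]

theorem IsIrreducibleUnitaryRep.isInvariant_imageStarAlgebra (hπ : IsIrreducibleUnitaryRep π) :
    Algebra.IsInvariant ℂ (imageStarAlgebra π A) (conjAlgAut π A).range := by
  have := isMulCommutative_imageStarAlgebra π A
  refine ⟨fun x hx => ?_⟩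
  have := isStarNormal_coe_of_isMulCommutative _ x
  obtain ⟨c, hc⟩ := hπ.exists_eq_algebraMap_of_isStarNormal (T := x) fun g =>
    (conjAlgAut_apply_eq_iff π A).1 (hx ⟨_, g, rfl⟩)
  exact ⟨c, Subtype.ext hc.symm⟩

end Schur

section Weights

variable {G : Type*} [Group G] {H : Type*} [NormedAddCommGroup H] [InnerProductSpace ℂ H]
  [CompleteSpace H]

theorem norm_eq_one_of_unitary_apply_eq_smul (u : unitary (H →L[ℂ] H)) {w : H} (hw : w ≠ 0) {c : ℂ}
    (h : (u : H →L[ℂ] H) w = c • w) : ‖c‖ = 1 := by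
  have hnorm : ‖w‖ = ‖c‖ * ‖w‖ := by rw [← norm_smul, ← h, Unitary.norm_map]
  exact (mul_eq_right₀ (norm_ne_zero_iff.2 hw)).1 hnorm.symm

/-- The joint eigenspace of the operators `π a`, `a ∈ A`, with eigenvalues `χ a`. -/
def weightSpace (π : G →* unitary (H →L[ℂ] H)) {A : Subgroup G} (χ : A →* Circle) :
    Submodule ℂ H where
  carrier := {x | ∀ a : A, (π a : H →L[ℂ] H) x = χ a • x}
  zero_mem' a := by rw [map_zero, smul_zero]
  add_mem' hx hy a := by rw [map_add, hx, hy, smul_add]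
  smul_mem' c x hx a := by rw [map_smul, hx, smul_comm]

open scoped IsMulCommutative in
theorem IsIrreducibleUnitaryRep.exists_weightSpace_ne_bot {π : G →* unitary (H →L[ℂ] H)}
    (hπ : IsIrreducibleUnitaryRep π) (A : Subgroup G) [A.Normal] [IsMulCommutative A]
    [A.FiniteIndex] : ∃ χ : A →* Circle, weightSpace π χ ≠ ⊥ := by
  have := hπ.1
  have := isMulCommutative_imageStarAlgebra π A
  have := isReduced_of_isMulCommutative (imageStarAlgebra π A)
  have := hπ.isInvariant_imageStarAlgebra (A := A)
  obtain ⟨φ, b, hb, hφ⟩ := exists_algHom_exists_mul_eq_smul (k := ℂ) (B := imageStarAlgebra π A)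
    (Γ := (conjAlgAut π A).range)
  obtain ⟨y, hy⟩ : ∃ y, (b : H →L[ℂ] H) y ≠ 0 := by
    by_contra! h
    exact hb (Subtype.ext (ContinuousLinearMap.ext h))
  let ρ : A →* imageStarAlgebra π A :=
    (((unitary (H →L[ℂ] H)).subtype.comp π).comp A.subtype).codRestrict _
      (apply_mem_imageStarAlgebra π)
  have hweight (a : A) : (π a : H →L[ℂ] H) ((b : H →L[ℂ] H) y) = φ (ρ a) • (b : H →L[ℂ] H) y :=
    DFunLike.congr_fun (congrArg Subtype.val (hφ (ρ a))) y
  have hnorm (a : A) : ‖φ (ρ a)‖ = 1 := norm_eq_one_of_unitary_apply_eq_smul (π a) hy (hweight a)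
  let χ : A →* Circle := ((φ : imageStarAlgebra π A →* ℂ).comp ρ).codRestrict
    (Submonoid.unitSphere ℂ) fun a => mem_sphere_zero_iff_norm.2 (hnorm a)
  exact ⟨χ, (Submodule.ne_bot_iff _).2 ⟨_, hweight, hy⟩⟩

end Weights

section LineStabilizer

variable {G : Type*} [Group G] {H : Type*} [NormedAddCommGroup H] [InnerProductSpace ℂ H]
  [CompleteSpace H] {π : G →* unitary (H →L[ℂ] H)}

theorem unitaryRep_mul_apply (π : G →* unitary (H →L[ℂ] H)) (g k : G) (x : H) :
    (π (g * k) : H →L[ℂ] H) x = (π g : H →L[ℂ] H) ((π k : H →L[ℂ] H) x) := by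
  rw [map_mul, Submonoid.coe_mul, mul_apply_eq_comp]

theorem unitaryRep_inv_apply_eq_iff (π : G →* unitary (H →L[ℂ] H)) {g : G} {x y : H} :
    (π g⁻¹ : H →L[ℂ] H) x = y ↔ x = (π g : H →L[ℂ] H) y := by
  constructor <;> rintro rfl <;> rw [← unitaryRep_mul_apply]
  · rw [mul_inv_cancel, map_one]
    rfl
  · rw [inv_mul_cancel, map_one]
    rfl

theorem unitaryRep_apply_circle_smul (π : G →* unitary (H →L[ℂ] H)) (g : G) (c : Circle) (x : H) :
    (π g : H →L[ℂ] H) (c • x) = c • (π g : H →L[ℂ] H) x :=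
  map_smul (π g : H →L[ℂ] H) (c : ℂ) x

/-- The stabilizer of the line `ℂ w` under `π`. Eigenvalues of unitaries have modulus one, so they
are taken in `Circle`, which makes inverses available also for `w = 0`. -/
def lineStabilizer (π : G →* unitary (H →L[ℂ] H)) (w : H) : Subgroup G where
  carrier := {g | ∃ c : Circle, (π g : H →L[ℂ] H) w = c • w}
  one_mem' := ⟨1, by simp⟩
  mul_mem' := by
    rintro g k ⟨c, hc⟩ ⟨d, hd⟩
    exact ⟨d * c, by rw [unitaryRep_mul_apply, hd, unitaryRep_apply_circle_smul, hc, mul_smul]⟩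
  inv_mem' := by
    rintro g ⟨c, hc⟩
    refine ⟨c⁻¹, (unitaryRep_inv_apply_eq_iff π).2 ?_⟩
    rw [unitaryRep_apply_circle_smul, hc, inv_smul_smul]

theorem le_lineStabilizer_of_mem_weightSpace {A : Subgroup G} {χ : A →* Circle} {w : H}
    (hw : w ∈ weightSpace π χ) : A ≤ lineStabilizer π w :=
  fun a ha => ⟨χ ⟨a, ha⟩, hw ⟨a, ha⟩⟩

theorem mem_lineStabilizer_of_apply_eq_smul {w : H} {g : G} {c : ℂ}
    (h : (π g : H →L[ℂ] H) w = c • w) : g ∈ lineStabilizer π w := by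
  rcases eq_or_ne w 0 with rfl | hw
  · exact ⟨1, by simp⟩
  · have hc := norm_eq_one_of_unitary_apply_eq_smul (π g) hw h
    exact ⟨⟨c, mem_sphere_zero_iff_norm.2 hc⟩, h⟩

theorem apply_mem_span_range_out (π : G →* unitary (H →L[ℂ] H)) (w : H) (g : G) :
    (π g : H →L[ℂ] H) w ∈ Submodule.span ℂ
      (Set.range fun q : G ⧸ lineStabilizer π w => (π q.out : H →L[ℂ] H) w) := by
  obtain ⟨⟨s, c, hc⟩, hs⟩ := QuotientGroup.mk_out_eq_mul (lineStabilizer π w) g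
  have hout : (π g : H →L[ℂ] H) w =
      (c⁻¹ : Circle) • (π (g : G ⧸ lineStabilizer π w).out : H →L[ℂ] H) w := by
    rw [hs, unitaryRep_mul_apply, hc, unitaryRep_apply_circle_smul, inv_smul_smul]
  rw [hout]
  exact Submodule.smul_mem _ ((c⁻¹ : Circle) : ℂ) (Submodule.subset_span ⟨_, rfl⟩)

theorem IsIrreducibleUnitaryRep.span_range_out_eq_top (hπ : IsIrreducibleUnitaryRep π) {w : H}
    (hw : w ≠ 0) [(lineStabilizer π w).FiniteIndex] :
    Submodule.span ℂ
      (Set.range fun q : G ⧸ lineStabilizer π w => (π q.out : H →L[ℂ] H) w) = ⊤ := by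
  set K := Submodule.span ℂ
    (Set.range fun q : G ⧸ lineStabilizer π w => (π q.out : H →L[ℂ] H) w) with hK
  have : FiniteDimensional ℂ K := FiniteDimensional.span_of_finite ℂ (Set.finite_range _)
  have hinv (g : G) : K ≤ K.comap (π g : H →L[ℂ] H).toLinearMap := by
    conv_lhs => rw [hK]
    rw [Submodule.span_le]
    rintro _ ⟨q, rfl⟩
    have := apply_mem_span_range_out π w (g * q.out)
    rwa [unitaryRep_mul_apply] at this
  refine (hπ.2 K K.closed_of_finiteDimensional hinv).resolve_left fun h => hw ?_
  have hwK : w ∈ K := by simpa using apply_mem_span_range_out π w 1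
  rwa [h, Submodule.mem_bot] at hwK

theorem IsIrreducibleUnitaryRep.finiteDimensional (hπ : IsIrreducibleUnitaryRep π) {w : H}
    (hw : w ≠ 0) [(lineStabilizer π w).FiniteIndex] : FiniteDimensional ℂ H :=
  Module.finite_def.2 (hπ.span_range_out_eq_top hw ▸ Submodule.fg_span (Set.finite_range _))

theorem hilbertDim_eq_finrank (H : Type*) [NormedAddCommGroup H] [InnerProductSpace ℂ H]
    [FiniteDimensional ℂ H] : hilbertDim H = Module.finrank ℂ H := by
  rw [hilbertDim, ← Module.finrank_eq_rank, map_natCast]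

theorem IsIrreducibleUnitaryRep.hilbertDim_le_index_lineStabilizer
    (hπ : IsIrreducibleUnitaryRep π) {w : H} (hw : w ≠ 0) [(lineStabilizer π w).FiniteIndex] :
    hilbertDim H ≤ ((lineStabilizer π w).index : ℕ∞) := by
  have := Fintype.ofFinite (G ⧸ lineStabilizer π w)
  have := hπ.finiteDimensional hw
  have hle := finrank_range_le_card (R := ℂ)
    fun q : G ⧸ lineStabilizer π w => (π q.out : H →L[ℂ] H) w
  rw [Set.finrank, hπ.span_range_out_eq_top hw, finrank_top, ← Nat.card_eq_fintype_card] at hle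
  rw [hilbertDim_eq_finrank, Subgroup.index_eq_card]
  exact_mod_cast hle

end LineStabilizer

section ConjugationOfWeights

variable {G : Type*} [Group G] {A : Subgroup G} [A.Normal] {H : Type*} [NormedAddCommGroup H]
  [InnerProductSpace ℂ H] [CompleteSpace H] {π : G →* unitary (H →L[ℂ] H)}

theorem apply_mem_weightSpace (π : G →* unitary (H →L[ℂ] H)) {χ : A →* Circle} (g : G) {x : H}
    (hx : x ∈ weightSpace π χ) :
    (π g : H →L[ℂ] H) x ∈ weightSpace π (conjCharAction A g χ) := by
  intro a
  obtain ⟨b, hb⟩ : ∃ b : A, (b : G) = g⁻¹ * a * g :=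
    ⟨⟨_, by simpa using ‹A.Normal›.conj_mem a a.2 g⁻¹⟩, rfl⟩
  have hgb : (a : G) * g = g * b := by rw [hb, mul_assoc, mul_inv_cancel_left]
  rw [conjCharAction_apply A g χ a b hb, ← unitaryRep_mul_apply, hgb, unitaryRep_mul_apply, hx,
    unitaryRep_apply_circle_smul]

theorem IsIrreducibleUnitaryRep.mem_of_conjCharAction_eq [A.FiniteIndex]
    (hπ : IsIrreducibleUnitaryRep π) (hdim : hilbertDim H = (A.index : ℕ∞)) {χ : A →* Circle}
    (hχ : weightSpace π χ ≠ ⊥) {k : G} (hk : conjCharAction A k χ = χ) : k ∈ A := by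
  obtain ⟨y, hy, hy0⟩ := (Submodule.ne_bot_iff _).1 hχ
  have := Subgroup.finiteIndex_of_le (le_lineStabilizer_of_mem_weightSpace hy)
  have := hπ.finiteDimensional hy0
  have : Nontrivial (weightSpace π χ) := Submodule.nontrivial_iff_ne_bot.2 hχ
  -- The stabilizer of the line of an eigenvector `w` of `π k` in the weight space contains `A` and
  -- `k`, and its index bounds the dimension.
  let T : Module.End ℂ (weightSpace π χ) := (π k : H →L[ℂ] H).toLinearMap.restrict fun x hx =>
    (hk ▸ apply_mem_weightSpace π k hx : (π k : H →L[ℂ] H) x ∈ weightSpace π χ)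
  obtain ⟨c, hc⟩ := T.exists_eigenvalue
  obtain ⟨w, hw⟩ := hc.exists_hasEigenvector
  have hw0 : (w : H) ≠ 0 := fun h => hw.2 (Subtype.ext h)
  have hAS := le_lineStabilizer_of_mem_weightSpace w.2
  have hkS : k ∈ lineStabilizer π (w : H) :=
    mem_lineStabilizer_of_apply_eq_smul (congrArg Subtype.val hw.apply_eq_smul)
  have := Subgroup.finiteIndex_of_le hAS
  have hle := hdim ▸ hπ.hilbertDim_le_index_lineStabilizer hw0
  by_contra hkA
  exact (Subgroup.index_strictAnti (hAS.lt_of_not_ge fun h => hkA (h hkS))).not_ge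
    (by exact_mod_cast hle)

end ConjugationOfWeights

section PrincipalOrbit

variable {G : Type*} [Group G] {A : Subgroup G} [A.Normal] [IsMulCommutative A]

theorem injective_pointGroupAction_of_forall_mem {χ : A →* Circle}
    (h : ∀ k, conjCharAction A k χ = χ → k ∈ A) :
    Function.Injective fun d : G ⧸ A => pointGroupAction A d χ := by
  intro d d' hd
  induction d using QuotientGroup.induction_on with
  | H g =>
  induction d' using QuotientGroup.induction_on with
  | H g' =>
  refine QuotientGroup.eq.2 (h _ ?_)
  have hd' : conjCharAction A g χ = conjCharAction A g' χ := hd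
  rw [map_mul, Equiv.Perm.mul_apply, ← hd', ← Equiv.Perm.mul_apply, ← map_mul, inv_mul_cancel,
    map_one, Equiv.Perm.one_apply]

variable [A.FiniteIndex]

theorem hasPrincipalOrbit_iff_injective {χ : A →* Circle} :
    HasPrincipalOrbit A χ ↔ Function.Injective fun d : G ⧸ A => pointGroupAction A d χ := by
  have hcard : (A.index : ℕ∞) = (Set.univ : Set (G ⧸ A)).encard := by
    rw [A.index_eq_card, Set.encard_univ, ENat.card_eq_coe_natCard]
  rw [HasPrincipalOrbit, charOrbit, hcard, ← Set.image_univ, ← Set.injOn_univ]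
  exact ⟨fun h => Set.finite_univ.injOn_of_encard_image_eq h, fun h => h.encard_image⟩

variable {H : Type*} [NormedAddCommGroup H] [InnerProductSpace ℂ H] [CompleteSpace H]
  {π : G →* unitary (H →L[ℂ] H)}

theorem IsIrreducibleUnitaryRep.hilbertDim_le_index (hπ : IsIrreducibleUnitaryRep π)
    (A : Subgroup G) [A.Normal] [IsMulCommutative A] [A.FiniteIndex] :
    hilbertDim H ≤ (A.index : ℕ∞) := by
  obtain ⟨χ, hχ⟩ := hπ.exists_weightSpace_ne_bot A
  obtain ⟨w, hw, hw0⟩ := (Submodule.ne_bot_iff _).1 hχ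
  have hAS := le_lineStabilizer_of_mem_weightSpace hw
  have := Subgroup.finiteIndex_of_le hAS
  exact (hπ.hilbertDim_le_index_lineStabilizer hw0).trans
    (by exact_mod_cast Subgroup.index_antitone hAS)

theorem IsIrreducibleUnitaryRep.exists_hasPrincipalOrbit (hπ : IsIrreducibleUnitaryRep π)
    (hdim : hilbertDim H = (A.index : ℕ∞)) : ∃ χ : A →* Circle, HasPrincipalOrbit A χ := by
  obtain ⟨χ, hχ⟩ := hπ.exists_weightSpace_ne_bot A
  exact ⟨χ, hasPrincipalOrbit_iff_injective.2 (injective_pointGroupAction_of_forall_mem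
    fun _ => hπ.mem_of_conjCharAction_eq hdim hχ)⟩

end PrincipalOrbit

section IrreducibilityCriterion

variable {G : Type*} [Group G] {H : Type*} [NormedAddCommGroup H] [InnerProductSpace ℂ H]
  [CompleteSpace H] {π : G →* unitary (H →L[ℂ] H)}

open scoped InnerProductSpace

theorem inner_apply_of_apply_eq_smul {g : G} {v w : H} {c : Circle}
    (h : (π g : H →L[ℂ] H) v = c • w) (x : H) : ⟪w, (π g : H →L[ℂ] H) x⟫_ℂ = c * ⟪v, x⟫_ℂ := by
  have hw : w = ((c⁻¹ : Circle) : ℂ) • (π g : H →L[ℂ] H) v := by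
    rw [h]
    exact (inv_smul_smul c w).symm
  rw [hw, inner_smul_left, Unitary.inner_map_map, ← Circle.coe_inv_eq_conj, inv_inv]

theorem eq_zero_of_forall_sum_mul_character_eq_zero {A ι : Type*} [Monoid A] [Fintype ι]
    {χ : ι → A →* Circle} (hχ : Function.Injective χ) {c : ι → ℂ}
    (hc : ∀ a, ∑ i, c i * χ i a = 0) : c = 0 := by
  have hinj : Function.Injective fun i => Circle.coeHom.comp (χ i) := fun i j hij =>
    hχ (MonoidHom.ext fun a => Circle.ext (DFunLike.congr_fun hij a))
  have hli := (linearIndependent_monoidHom A ℂ).comp _ hinj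
  refine funext (Fintype.linearIndependent_iff.1 hli c (funext fun a => ?_))
  rw [Finset.sum_apply]
  exact hc a

theorem inner_mul_inner_eq_zero_of_forall_apply_mem {A : Subgroup G} {ι : Type*} [Fintype ι]
    (b : OrthonormalBasis ι ℂ H) {χ : ι → A →* Circle} (hχ : Function.Injective χ)
    (hb : ∀ i, b i ∈ weightSpace π (χ i)) {K : Submodule ℂ H}
    (hK : ∀ g, ∀ x ∈ K, (π g : H →L[ℂ] H) x ∈ K) {x y : H} (hx : x ∈ K) (hy : y ∈ Kᗮ) (i : ι) :
    ⟪y, b i⟫_ℂ * ⟪b i, x⟫_ℂ = 0 := by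
  refine congrFun (eq_zero_of_forall_sum_mul_character_eq_zero hχ
    (c := fun i => ⟪y, b i⟫_ℂ * ⟪b i, x⟫_ℂ) fun a => ?_) i
  calc ∑ i, ⟪y, b i⟫_ℂ * ⟪b i, x⟫_ℂ * χ i a
      = ∑ i, ⟪y, b i⟫_ℂ * ⟪b i, (π a : H →L[ℂ] H) x⟫_ℂ := by
        refine Finset.sum_congr rfl fun i _ => ?_
        rw [inner_apply_of_apply_eq_smul (hb i a), mul_assoc, mul_comm ⟪b i, x⟫_ℂ]
    _ = ⟪y, (π a : H →L[ℂ] H) x⟫_ℂ := b.sum_inner_mul_inner _ _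
    _ = 0 := Submodule.inner_left_of_mem_orthogonal (hK a x hx) hy

theorem isIrreducibleUnitaryRep_of_orthonormalBasis {A : Subgroup G} {ι : Type*} [Fintype ι]
    [Nonempty ι] (b : OrthonormalBasis ι ℂ H) {χ : ι → A →* Circle} (hχ : Function.Injective χ)
    (hb : ∀ i, b i ∈ weightSpace π (χ i))
    (htrans : ∀ i j, ∃ g, ∃ c : Circle, (π g : H →L[ℂ] H) (b i) = c • b j) :
    IsIrreducibleUnitaryRep π := by
  have hnontrivial : Nontrivial H := ⟨b (Classical.arbitrary ι), 0, b.orthonormal.ne_zero _⟩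
  refine ⟨hnontrivial, fun K hKc hK => or_iff_not_imp_left.2 fun hbot => ?_⟩
  obtain ⟨x, hx, hx0⟩ := (Submodule.ne_bot_iff K).1 hbot
  obtain ⟨i, hi⟩ : ∃ i, ⟪b i, x⟫_ℂ ≠ 0 := by
    by_contra! h
    exact hx0 (InnerProductSpace.ext_inner_left_basis b.toBasis fun i => by simpa using h i)
  have := hKc.completeSpace_coe
  refine Submodule.orthogonal_eq_bot_iff.1 ((Submodule.eq_bot_iff _).2 fun y hy => ?_)
  refine InnerProductSpace.ext_inner_right_basis b.toBasis fun j => ?_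
  obtain ⟨g, c, hg⟩ := htrans i j
  have hj : ⟪b j, (π g : H →L[ℂ] H) x⟫_ℂ ≠ 0 := by
    rw [inner_apply_of_apply_eq_smul hg]
    exact mul_ne_zero c.coe_ne_zero hi
  have hmul := inner_mul_inner_eq_zero_of_forall_apply_mem b hχ hb hK (hK g x hx) hy j
  simpa using (mul_eq_zero_iff_right hj).1 hmul

end IrreducibilityCriterion

section InducedRepresentation

variable {G : Type*} [Group G] {A : Subgroup G}

/-- The factor in `A` of the decomposition `g = q.out * a` with respect to the chosen
representatives `q.out` of the cosets `q : G ⧸ A`. -/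
noncomputable def cosetPart (A : Subgroup G) (g : G) : A :=
  ⟨(g : G ⧸ A).out⁻¹ * g, QuotientGroup.eq.1 (QuotientGroup.out_eq' _)⟩

theorem coe_cosetPart (g : G) : (cosetPart A g : G) = (g : G ⧸ A).out⁻¹ * g :=
  rfl

theorem cosetPart_mul (g : G) (a : A) : cosetPart A (g * a) = cosetPart A g * a := by
  ext
  rw [coe_cosetPart, QuotientGroup.mk_mul_of_mem g a.2, Subgroup.coe_mul, coe_cosetPart, mul_assoc]

theorem cosetPart_out (q : G ⧸ A) : cosetPart A q.out = 1 := by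
  ext
  rw [coe_cosetPart, QuotientGroup.out_eq', inv_mul_cancel, Subgroup.coe_one]

theorem out_mul_cosetPart (g : G) : (g : G ⧸ A).out * (cosetPart A g : G) = g := by
  rw [coe_cosetPart, mul_inv_cancel_left]

variable {H : Type*} [NormedAddCommGroup H] [InnerProductSpace ℂ H] [Fintype (G ⧸ A)]
  (b : OrthonormalBasis (G ⧸ A) ℂ H) (χ : A →* Circle)

/-- The family of unit vectors with `inducedFrame (q.out * a) = χ a • b q`. The induced
representation is defined by left translation of this family, so that no cocycle for the action on
the basis `b` has to be written down. -/
noncomputable def inducedFrame (g : G) : H :=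
  χ (cosetPart A g) • b g

theorem inducedFrame_mul (g : G) (a : A) :
    inducedFrame b χ (g * a) = χ a • inducedFrame b χ g := by
  rw [inducedFrame, cosetPart_mul, QuotientGroup.mk_mul_of_mem g a.2, map_mul, mul_comm, mul_smul,
    inducedFrame]

theorem inducedFrame_out (q : G ⧸ A) : inducedFrame b χ q.out = b q := by
  rw [inducedFrame, cosetPart_out, map_one, one_smul, QuotientGroup.out_eq']

theorem orthonormal_inducedFrame (h : G) :
    Orthonormal ℂ fun q : G ⧸ A => inducedFrame b χ (h * q.out) := by
  have hcoset (q : G ⧸ A) : ((h * q.out : G) : G ⧸ A) = h • q :=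
    congrArg (h • ·) (QuotientGroup.out_eq' q)
  refine ⟨fun q => ?_, fun q q' hqq' => ?_⟩
  · simp only [inducedFrame, Circle.norm_smul, b.norm_eq_one]
  · simp only [inducedFrame, Circle.smul_def, inner_smul_left, inner_smul_right, hcoset,
      b.inner_eq_zero ((MulAction.injective h).ne hqq'), mul_zero]

/-- The operator by which `h : G` acts in the representation induced from `χ`. -/
noncomputable def inducedIsometry (h : G) : H ≃ₗᵢ[ℂ] H :=
  have : FiniteDimensional ℂ H := b.toBasis.finiteDimensional_of_finite
  b.equiv (.mk (orthonormal_inducedFrame b χ h)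
    ((orthonormal_inducedFrame b χ h).linearIndependent.span_eq_top_of_card_eq_finrank'
      (Module.finrank_eq_card_basis b.toBasis).symm).ge) (Equiv.refl _)

theorem inducedIsometry_apply_basis (h : G) (q : G ⧸ A) :
    inducedIsometry b χ h (b q) = inducedFrame b χ (h * q.out) := by
  rw [inducedIsometry, OrthonormalBasis.equiv_apply_basis, OrthonormalBasis.coe_mk,
    Equiv.refl_apply]

theorem inducedIsometry_inducedFrame (h g : G) :
    inducedIsometry b χ h (inducedFrame b χ g) = inducedFrame b χ (h * g) := by
  calc inducedIsometry b χ h (inducedFrame b χ g)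
      = χ (cosetPart A g) • inducedFrame b χ (h * (g : G ⧸ A).out) := by
        rw [← inducedIsometry_apply_basis]
        exact map_smul _ (χ (cosetPart A g) : ℂ) (b g)
    _ = inducedFrame b χ (h * g) := by
        rw [← inducedFrame_mul, mul_assoc, out_mul_cosetPart]

theorem ext_inducedFrame {e f : H ≃ₗᵢ[ℂ] H}
    (h : ∀ g : G, e (inducedFrame b χ g) = f (inducedFrame b χ g)) : e = f :=
  b.toBasis.ext_linearIsometryEquiv fun q => by simpa [inducedFrame_out] using h q.out

/-- The representation of `G` induced from the character `χ` of `A`, realized on any Hilbert space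
with an orthonormal basis indexed by `G ⧸ A` (and so in any universe). -/
noncomputable def inducedRep [CompleteSpace H] : G →* unitary (H →L[ℂ] H) :=
  Unitary.linearIsometryEquiv.symm.toMonoidHom.comp
    { toFun := inducedIsometry b χ
      map_one' := ext_inducedFrame b χ fun g => by
        rw [inducedIsometry_inducedFrame, one_mul]
        rfl
      map_mul' := fun h k => ext_inducedFrame b χ fun g => by
        change _ = inducedIsometry b χ h (inducedIsometry b χ k _)
        simp only [inducedIsometry_inducedFrame, mul_assoc] }

variable [CompleteSpace H]

theorem inducedRep_inducedFrame (h g : G) :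
    (inducedRep b χ h : H →L[ℂ] H) (inducedFrame b χ g) = inducedFrame b χ (h * g) :=
  inducedIsometry_inducedFrame b χ h g

theorem exists_inducedRep_apply_basis (q q' : G ⧸ A) :
    ∃ g, ∃ c : Circle, (inducedRep b χ g : H →L[ℂ] H) (b q) = c • b q' :=
  ⟨q'.out * q.out⁻¹, 1, by
    rw [one_smul, ← inducedFrame_out b χ, inducedRep_inducedFrame, inv_mul_cancel_right,
      inducedFrame_out]⟩

theorem basis_mem_weightSpace_inducedRep [A.Normal] [IsMulCommutative A] (q : G ⧸ A) :
    b q ∈ weightSpace (inducedRep b χ) (pointGroupAction A q χ) := by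
  have hone : inducedFrame b χ 1 ∈ weightSpace (inducedRep b χ) χ := fun a => by
    rw [inducedRep_inducedFrame, mul_one, ← inducedFrame_mul, one_mul]
  have hq := apply_mem_weightSpace (inducedRep b χ) q.out hone
  have haction : pointGroupAction A q χ = conjCharAction A q.out χ :=
    congrArg (fun d => pointGroupAction A d χ) (QuotientGroup.out_eq' q).symm
  rwa [inducedRep_inducedFrame, mul_one, inducedFrame_out, ← haction] at hq

theorem isIrreducibleUnitaryRep_inducedRep [A.Normal] [IsMulCommutative A]
    (hχ : Function.Injective fun q : G ⧸ A => pointGroupAction A q χ) :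
    IsIrreducibleUnitaryRep (inducedRep b χ) :=
  isIrreducibleUnitaryRep_of_orthonormalBasis b hχ (basis_mem_weightSpace_inducedRep b χ)
    (exists_inducedRep_apply_basis b χ)

end InducedRepresentation

theorem index_mem_irreducibleDims {G : Type u} [Group G] {A : Subgroup G} [A.Normal]
    [IsMulCommutative A] [A.FiniteIndex] {χ : A →* Circle} (hχ : HasPrincipalOrbit A χ) :
    (A.index : ℕ∞) ∈ irreducibleDims.{u, v} G := by
  have : Fintype (G ⧸ A) := Fintype.ofFinite _
  have e : ULift.{v} (Fin A.index) ≃ G ⧸ A :=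
    Equiv.ulift.trans (Finite.equivFinOfCardEq A.index_eq_card.symm).symm
  let b : OrthonormalBasis (G ⧸ A) ℂ (EuclideanSpace ℂ (ULift.{v} (Fin A.index))) :=
    (EuclideanSpace.basisFun _ ℂ).reindex e
  refine ⟨_, _, _, inferInstance, inducedRep b χ,
    isIrreducibleUnitaryRep_inducedRep b χ (hasPrincipalOrbit_iff_injective.1 hχ), ?_⟩
  rw [hilbertDim_eq_finrank, finrank_euclideanSpace, Fintype.card_ulift, Fintype.card_fin]

theorem corollary4p12_general {G : Type u} [Group G] (A : Subgroup G) [A.Normal]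
    [IsMulCommutative A] [A.FiniteIndex] :
    (∀ (H : Type v) [NormedAddCommGroup H] [InnerProductSpace ℂ H] [CompleteSpace H]
      (π : G →* unitary (H →L[ℂ] H)), IsIrreducibleUnitaryRep π →
        hilbertDim H ≤ (A.index : ℕ∞)) ∧
    ((A.index : ℕ∞) ∈ irreducibleDims.{u, v} G ↔
      ∃ χ : A →* Circle, HasPrincipalOrbit A χ) ∧
    (IsCrystalLike A ↔ IsGreatest (irreducibleDims.{u, v} G) (A.index : ℕ∞)) := by
  have hle : (A.index : ℕ∞) ∈ upperBounds (irreducibleDims.{u, v} G) := by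
    rintro _ ⟨H, _, _, _, π, hπ, rfl⟩
    exact hπ.hilbertDim_le_index A
  have hiff : (A.index : ℕ∞) ∈ irreducibleDims.{u, v} G ↔
      ∃ χ : A →* Circle, HasPrincipalOrbit A χ :=
    ⟨fun ⟨_, _, _, _, _, hπ, hdim⟩ => hπ.exists_hasPrincipalOrbit hdim,
      fun ⟨_, hχ⟩ => index_mem_irreducibleDims hχ⟩
  exact ⟨fun _ _ _ _ _ hπ => hπ.hilbertDim_le_index A, hiff,
    fun h => ⟨hiff.2 h, hle⟩, fun h => hiff.1 h.1⟩

theorem corollary4p12 {G : Type u} [Group G] (A : Subgroup G) [IsGroupLatticePair A] :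
    (∀ (H : Type v) [NormedAddCommGroup H] [InnerProductSpace ℂ H] [CompleteSpace H]
      (π : G →* unitary (H →L[ℂ] H)), IsIrreducibleUnitaryRep π →
        hilbertDim H ≤ (A.index : ℕ∞)) ∧
    ((A.index : ℕ∞) ∈ irreducibleDims.{u, v} G ↔
      ∃ χ : A →* Circle, HasPrincipalOrbit A χ) ∧
    (IsCrystalLike A ↔ IsGreatest (irreducibleDims.{u, v} G) (A.index : ℕ∞)) :=
  corollary4p12_general A
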